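/- Let $G$ be a finite group. For $u,g\in G$ and a positive integer $n$ put $G_n(u,g)=\{a\in G : (au^{-1})^n=a^n=g\}$. Let $D(G)$ be the Drinfel'd double of $G$ over $\mathbb{C}$, with normalized integral $\Lambda$, and for a representation $V$ of $D(G)$ with character $\chi$ let $\nu_n(V)=\chi(\Lambda^{[n]})$ be its $n$-th Frobenius–Schur indicator, where $h^{[n]}=h_1h_2\cdots h_n$ in Sweedler notation. $G$ is called an $FSZ$-group if $\nu_n(V)\in\mathbb{Z}$ for every irreducible representation $V$ of $D(G)$ and every $n\ge 1$. $G$ is called an $FSZ^+$-group if for every $n\ge 1$, all commuting $u,g\in G$ and all integers $m$ with $\gcd(m,|G|)=1$, the sets $G_n(u,g)$ and $G_n(u,g^m)$, on which $C_G(u,g)$ (the subgroup of elements commuting with both $u$ and $g$) acts by conjugation, afford isomorphic complex permutation modules for $C_G(u,g)$. Then: 1. Every finite abelian group is an $FSZ$-group. 2. Every finite dihedral group (of order $2k$, $k\ge 1$) is an $FSZ$-group. 3. For every prime power $q\ge 2$, the centralizer of each nonidentity element of $PSL_2(q)$ is abelian or dihedral. 4. For every prime power $q\ge 2$, $PSL_2(q)$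 is an $FSZ^+$-group. -/

import Mathlib

open scoped TensorProduct

noncomputable section

/-- The underlying complex vector space of the Drinfel'd double `D(G)` of a group `G`:
it has a basis `e_g x`, indexed by the pairs `(g, x)` of elements of `G`. -/
def DrinfeldDouble (G : Type*) : Type _ := G × G →₀ ℂ

namespace DrinfeldDouble

variable {G : Type*}

instance : AddCommGroup (DrinfeldDouble G) := inferInstanceAs (AddCommGroup (G × G →₀ ℂ))

instance : Module ℂ (DrinfeldDouble G) := inferInstanceAs (Module ℂ (G × G →₀ ℂ))

/-- The basis vectors `e_g x`, as a basis indexed by `(g, x)`. -/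
def basis (G : Type*) : Module.Basis (G × G) ℂ (DrinfeldDouble G) :=
  Module.Basis.ofRepr (LinearEquiv.refl ℂ (G × G →₀ ℂ))

/-- The basis vector `e_g x` of `D(G)`. -/
def e (g x : G) : DrinfeldDouble G := basis G (g, x)

theorem hom_ext {M : Type*} [AddCommMonoid M] [Module ℂ M]
    {f k : DrinfeldDouble G →ₗ[ℂ] M} (h : ∀ g x, f (e g x) = k (e g x)) : f = k :=
  (basis G).ext fun p => h p.1 p.2

variable [Group G]

open Classical in
/-- The multiplication of `D(G)` as a bilinear map:
`(e_g x) (e_h y) = δ_{g, x h x⁻¹} e_g (x y)`. -/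
def mulHom (G : Type*) [Group G] :
    DrinfeldDouble G →ₗ[ℂ] DrinfeldDouble G →ₗ[ℂ] DrinfeldDouble G :=
  (basis G).constr ℂ fun p => (basis G).constr ℂ fun q =>
    if p.1 = p.2 * q.1 * p.2⁻¹ then e p.1 (p.2 * q.2) else 0

instance : Mul (DrinfeldDouble G) := ⟨fun a b => mulHom G a b⟩

theorem mul_def (a b : DrinfeldDouble G) : a * b = mulHom G a b := rfl

open Classical in
theorem e_mul_e (g x h y : G) :
    e g x * e h y = if g = x * h * x⁻¹ then e g (x * y) else 0 := by
  simp [mul_def, mulHom, e, Module.Basis.constr_basis]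

theorem mulHom_e (g x h y : G) : mulHom G (e g x) (e h y) = e g x * e h y := rfl

theorem mul_assoc_aux (a b c : DrinfeldDouble G) : a * b * c = a * (b * c) := by
  classical
  have : (mulHom G).compr₂ (mulHom G) =
      ((LinearMap.llcomp ℂ (DrinfeldDouble G) (DrinfeldDouble G) (DrinfeldDouble G)).flip.comp
        (mulHom G)).flip.comp (mulHom G) := by
    refine hom_ext fun g x => hom_ext fun h y => hom_ext fun k z => ?_
    simp only [LinearMap.compr₂_apply, LinearMap.comp_apply, LinearMap.flip_apply,
      LinearMap.llcomp_apply, mulHom_e, e_mul_e]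
    have key : ∀ t : G, x * y * t * (x * y)⁻¹ = x * (y * t * y⁻¹) * x⁻¹ := fun t => by group
    by_cases h2 : h = y * k * y⁻¹
    · by_cases h1 : g = x * h * x⁻¹
      · rw [if_pos h1, if_pos h2, mulHom_e, mulHom_e, e_mul_e, e_mul_e, if_pos h1, key, ← h2,
          if_pos h1, mul_assoc]
      · rw [if_neg h1, if_pos h2, mulHom_e, e_mul_e, if_neg h1]
        simp
    · rw [if_neg h2, map_zero]
      split_ifs with h1
      · rw [mulHom_e, e_mul_e, key, if_neg]
        rintro rfl
        exact h2 (by simpa using h1.symm)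
      · simp
  exact LinearMap.congr_fun (LinearMap.congr_fun (LinearMap.congr_fun this a) b) c

variable [Fintype G]

/-- The unit `1 = ∑_g e_g 1` of `D(G)`. -/
instance : One (DrinfeldDouble G) := ⟨∑ g : G, e g 1⟩

theorem one_def : (1 : DrinfeldDouble G) = ∑ g : G, e g 1 := rfl

theorem one_mul_aux (a : DrinfeldDouble G) : 1 * a = a := by
  classical
  have : mulHom G 1 = LinearMap.id := by
    refine hom_ext fun h y => ?_
    simp [one_def, mulHom_e, e_mul_e]
  exact LinearMap.congr_fun this a

theorem mul_one_aux (a : DrinfeldDouble G) : a * 1 = a := by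
  classical
  have : (mulHom G).flip 1 = LinearMap.id := by
    refine hom_ext fun g x => ?_
    have hh : ∀ h : G, g = x * h * x⁻¹ ↔ h = x⁻¹ * g * x := fun h => by
      constructor <;> rintro rfl <;> group
    simp [one_def, mulHom_e, e_mul_e, hh]
  exact LinearMap.congr_fun this a

instance : Ring (DrinfeldDouble G) where
  __ := (inferInstance : AddCommGroup (DrinfeldDouble G))
  mul := (· * ·)
  one := 1
  left_distrib a b c := map_add (mulHom G a) b c
  right_distrib a b c := by simp [mul_def]
  zero_mul a := by simp [mul_def]
  mul_zero a := by simp [mul_def]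
  mul_assoc := mul_assoc_aux
  one_mul := one_mul_aux
  mul_one := mul_one_aux

instance : Algebra ℂ (DrinfeldDouble G) :=
  Algebra.ofModule (fun r a b => by simp [mul_def]) (fun r a b => by simp [mul_def])

/-- The comultiplication `Δ(e_g x) = ∑_{a b = g} e_a x ⊗ e_b x` and the counit
`ε(e_g x) = δ_{g, 1}` of `D(G)`. -/
instance : CoalgebraStruct ℂ (DrinfeldDouble G) where
  comul := (basis G).constr ℂ fun p => ∑ a : G, e a p.2 ⊗ₜ[ℂ] e (a⁻¹ * p.1) p.2
  counit := by
    classical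
    exact (basis G).constr ℂ fun p => if p.1 = 1 then 1 else 0

theorem comul_e (g x : G) :
    Coalgebra.comul (R := ℂ) (e g x) = ∑ a : G, e a x ⊗ₜ[ℂ] e (a⁻¹ * g) x := by
  exact (basis G).constr_basis ℂ _ (g, x)

open Classical in
theorem counit_e (g x : G) :
    Coalgebra.counit (R := ℂ) (e g x) = if g = 1 then 1 else 0 := by
  refine ((basis G).constr_basis ℂ _ (g, x)).trans ?_
  congr

instance : Coalgebra ℂ (DrinfeldDouble G) where
  coassoc := by
    refine hom_ext fun g x => ?_
    simp only [LinearMap.comp_apply, comul_e, map_sum, LinearMap.rTensor_tmul,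
      LinearMap.lTensor_tmul, TensorProduct.sum_tmul, TensorProduct.tmul_sum,
      LinearEquiv.coe_coe, TensorProduct.assoc_tmul]
    rw [Finset.sum_comm]
    refine Finset.sum_congr rfl fun a _ => ?_
    refine Fintype.sum_equiv (Equiv.mulLeft a⁻¹) _ _ fun b => ?_
    simp [mul_assoc]
  rTensor_counit_comp_comul := by
    classical
    refine hom_ext fun g x => ?_
    simp [comul_e, counit_e, TensorProduct.ite_tmul]
  lTensor_counit_comp_comul := by
    classical
    refine hom_ext fun g x => ?_
    simp [comul_e, counit_e, TensorProduct.tmul_ite, inv_mul_eq_one]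

theorem counit_mul_aux (a b : DrinfeldDouble G) :
    Coalgebra.counit (R := ℂ) (a * b) = Coalgebra.counit (R := ℂ) a * Coalgebra.counit (R := ℂ) b := by
  classical
  have : (mulHom G).compr₂ (Coalgebra.counit (R := ℂ)) =
      (LinearMap.mul ℂ ℂ).compl₁₂ (Coalgebra.counit (R := ℂ)) (Coalgebra.counit (R := ℂ)) := by
    refine hom_ext fun g x => hom_ext fun h y => ?_
    simp only [LinearMap.compr₂_apply, LinearMap.compl₁₂_apply, LinearMap.mul_apply', mulHom_e,
      e_mul_e, counit_e]
    by_cases hg : g = 1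
    · subst hg
      by_cases hh : h = 1
      · subst hh; simp [counit_e]
      · have : ¬ (1 : G) = x * h * x⁻¹ := fun t => hh (by simpa using t.symm)
        simp [hh, this]
    · split_ifs <;> simp [counit_e, hg]
  exact LinearMap.congr_fun (LinearMap.congr_fun this a) b

theorem comul_mul_aux (a b : DrinfeldDouble G) :
    Coalgebra.comul (R := ℂ) (a * b) = Coalgebra.comul (R := ℂ) a * Coalgebra.comul (R := ℂ) b := by
  classical
  have : (mulHom G).compr₂ (Coalgebra.comul (R := ℂ)) =
      (LinearMap.mul ℂ (DrinfeldDouble G ⊗[ℂ] DrinfeldDouble G)).compl₁₂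
        (Coalgebra.comul (R := ℂ)) (Coalgebra.comul (R := ℂ)) := by
    refine hom_ext fun g x => hom_ext fun h y => ?_
    simp only [LinearMap.compr₂_apply, LinearMap.compl₁₂_apply, LinearMap.mul_apply', mulHom_e,
      comul_e, Finset.sum_mul, Finset.mul_sum, Algebra.TensorProduct.tmul_mul_tmul, e_mul_e]
    have step : ∀ c : G, (∑ d : G, (if c = x * d * x⁻¹ then e c (x * y) else 0) ⊗ₜ[ℂ]
        (if c⁻¹ * g = x * (d⁻¹ * h) * x⁻¹ then e (c⁻¹ * g) (x * y) else 0)) =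
        if g = x * h * x⁻¹ then e c (x * y) ⊗ₜ[ℂ] e (c⁻¹ * g) (x * y) else 0 := fun c => by
      rw [Finset.sum_eq_single (x⁻¹ * c * x)]
      · have h1 : x * (x⁻¹ * c * x) * x⁻¹ = c := by group
        have h2 : x * ((x⁻¹ * c * x)⁻¹ * h) * x⁻¹ = c⁻¹ * (x * h * x⁻¹) := by group
        rw [h1, h2, if_pos rfl]
        simp only [mul_right_inj]
        split_ifs <;> simp
      · intro d _ hd
        rw [if_neg, TensorProduct.zero_tmul]
        rintro rfl
        exact hd (by group)
      · simp
    rw [Finset.sum_comm]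
    simp only [step]
    split_ifs
    · rw [comul_e]
    · simp
  exact LinearMap.congr_fun (LinearMap.congr_fun this a) b

instance : Bialgebra ℂ (DrinfeldDouble G) :=
  Bialgebra.mk' ℂ (DrinfeldDouble G)
    (by classical simp [one_def, counit_e])
    (fun {a b} => counit_mul_aux a b)
    (by
      rw [Algebra.TensorProduct.one_def, one_def]
      simp only [map_sum, comul_e, TensorProduct.sum_tmul, TensorProduct.tmul_sum]
      rw [Finset.sum_comm]
      nth_rewrite 2 [Finset.sum_comm]
      refine Finset.sum_congr rfl fun a _ => ?_
      exact Fintype.sum_equiv (Equiv.mulLeft a⁻¹) _ _ fun b => by simp)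
    (fun {a b} => comul_mul_aux a b)

/-- The antipode `S(e_g x) = e_{x⁻¹ g⁻¹ x} x⁻¹` of `D(G)`. -/
instance : HopfAlgebraStruct ℂ (DrinfeldDouble G) where
  antipode := (basis G).constr ℂ fun p => e (p.2⁻¹ * p.1⁻¹ * p.2) p.2⁻¹

theorem antipode_e (g x : G) :
    HopfAlgebra.antipode ℂ (e g x) = e (x⁻¹ * g⁻¹ * x) x⁻¹ :=
  (basis G).constr_basis ℂ _ (g, x)

instance : HopfAlgebra ℂ (DrinfeldDouble G) where
  mul_antipode_rTensor_comul := by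
    classical
    refine hom_ext fun g x => ?_
    have hh : ∀ a : G, x⁻¹ * a⁻¹ * x = x⁻¹ * (a⁻¹ * g) * x⁻¹⁻¹ ↔ g = 1 := fun a => by
      simp [mul_assoc]
    simp only [LinearMap.comp_apply, comul_e, map_sum, LinearMap.rTensor_tmul,
      LinearMap.mul'_apply, antipode_e, e_mul_e, hh, counit_e]
    split_ifs
    · simp only [inv_mul_cancel, Algebra.linearMap_apply, map_one, one_def]
      exact Fintype.sum_equiv ((Equiv.inv G).trans (MulAut.conj x⁻¹).toEquiv) _ _
        fun b => by simp
    · simp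
  mul_antipode_lTensor_comul := by
    classical
    refine hom_ext fun g x => ?_
    have hh : ∀ a : G, a = x * (x⁻¹ * (a⁻¹ * g)⁻¹ * x) * x⁻¹ ↔ g = 1 := fun a => by
      simp [mul_assoc]
    simp only [LinearMap.comp_apply, comul_e, map_sum, LinearMap.lTensor_tmul,
      LinearMap.mul'_apply, antipode_e, e_mul_e, hh, counit_e]
    split_ifs
    · simp [one_def]
    · simp

/-- The normalized integral `Λ = |G|⁻¹ ∑_x e_1 x` of `D(G)`. -/
def integral (G : Type*) [Group G] [Fintype G] : DrinfeldDouble G :=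
  (Fintype.card G : ℂ)⁻¹ • ∑ x : G, e 1 x

/-- `Λ` is a two-sided integral of `D(G)` and is normalized by `ε(Λ) = 1`; these properties
determine `Λ`. -/
theorem integral_spec :
    (∀ a : DrinfeldDouble G, a * integral G = Coalgebra.counit (R := ℂ) a • integral G) ∧
    (∀ a : DrinfeldDouble G, integral G * a = Coalgebra.counit (R := ℂ) a • integral G) ∧
    Coalgebra.counit (R := ℂ) (integral G) = 1 := by
  classical
  refine ⟨fun a => ?_, fun a => ?_, ?_⟩
  · have : (mulHom G).flip (integral G) =
        (Coalgebra.counit (R := ℂ) (A := DrinfeldDouble G)).smulRight (integral G) := by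
      refine hom_ext fun g x => ?_
      rw [LinearMap.flip_apply]
      simp only [integral, map_smul, map_sum, mulHom_e, e_mul_e,
        LinearMap.smulRight_apply, counit_e, mul_one, mul_inv_cancel]
      split_ifs with h
      · subst h
        rw [one_smul]
        congr 1
        exact Fintype.sum_equiv (Equiv.mulLeft x) _ _ fun b => rfl
      · simp
    exact LinearMap.congr_fun this a
  · have : mulHom G (integral G) =
        (Coalgebra.counit (R := ℂ) (A := DrinfeldDouble G)).smulRight (integral G) := by
      refine hom_ext fun g x => ?_
      have hh : ∀ y : G, 1 = y * g * y⁻¹ ↔ g = 1 := fun y => by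
        rw [eq_comm, conj_eq_one_iff]
      simp only [integral, map_smul, map_sum, LinearMap.smul_apply, LinearMap.sum_apply, mulHom_e,
        e_mul_e, LinearMap.smulRight_apply, counit_e, hh]
      split_ifs with h
      · rw [one_smul]
        congr 1
        exact Fintype.sum_equiv (Equiv.mulRight x) _ _ fun b => rfl
      · simp
    exact LinearMap.congr_fun this a
  · simp [integral, counit_e]

end DrinfeldDouble

/-- The Sweedler power map `h ↦ h^{[n]} = h₁ h₂ ⋯ hₙ` of a complex Hopf algebra, with
`h^{[0]} = ε(h) 1`. -/
def sweedlerPow (H : Type*) [Ring H] [HopfAlgebra ℂ H] : ℕ → H →ₗ[ℂ] H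
  | 0 => Algebra.linearMap ℂ H ∘ₗ Coalgebra.counit
  | n + 1 => LinearMap.mul' ℂ H ∘ₗ (sweedlerPow H n).lTensor H ∘ₗ Coalgebra.comul

/-- The `n`-th Frobenius-Schur indicator `ν_n(V) = χ_V(Λ^{[n]})` of a representation `V` of the
Drinfel'd double `D(G)`. -/
def fsIndicator (G : Type*) [Group G] [Fintype G] (n : ℕ) (V : Type*) [AddCommGroup V]
    [Module ℂ V] [Module (DrinfeldDouble G) V] [IsScalarTower ℂ (DrinfeldDouble G) V] : ℂ :=
  LinearMap.trace ℂ V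
    (Algebra.lsmul ℂ ℂ V (sweedlerPow (DrinfeldDouble G) n (DrinfeldDouble.integral G)))

/-- `G` is an `FSZ_n`-group: the `n`-th indicator of every irreducible representation of `D(G)` is
an integer. (Every such representation is finite dimensional, so it is isomorphic to one whose
underlying space lies in `Type`.) -/
def IsFSZn (n : ℕ) (G : Type*) [Group G] [Fintype G] : Prop :=
  ∀ (V : Type) [AddCommGroup V] [Module ℂ V] [FiniteDimensional ℂ V]
    [Module (DrinfeldDouble G) V] [IsScalarTower ℂ (DrinfeldDouble G) V]
    [IsSimpleModule (DrinfeldDouble G) V], ∃ k : ℤ, fsIndicator G n V = k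

/-- `G` is an `FSZ`-group: it is an `FSZ_n`-group for every positive integer `n`. -/
def IsFSZ (G : Type*) [Group G] [Fintype G] : Prop :=
  ∀ n : ℕ, 0 < n → IsFSZn n G

/-- The set `G_n(u, g) = {a ∈ G | (a u⁻¹)^n = a^n = g}`. -/
def gSet {G : Type*} [Group G] (n : ℕ) (u g : G) : Set G :=
  {a | (a * u⁻¹) ^ n = a ^ n ∧ a ^ n = g}

/-- The subgroup `C_G(u, g)` of the elements that commute with both `u` and `g`. -/
abbrev pairCentralizer {G : Type*} [Group G] (u g : G) : Subgroup G :=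
  Subgroup.centralizer {u, g}

/-- The action by conjugation of a subgroup `K` of `G` on a set `S` of elements of `G` that is
stable under conjugation by `K`. -/
@[reducible] def conjActionOn {G : Type*} [Group G] (K : Subgroup G) (S : Set G)
    (hS : ∀ h ∈ K, ∀ a ∈ S, h * a * h⁻¹ ∈ S) : MulAction K S where
  smul h a := ⟨h * a * (h : G)⁻¹, hS h h.2 a a.2⟩
  one_smul a := Subtype.ext (show (1 : G) * a * (1 : G)⁻¹ = a by simp)
  mul_smul h k a := Subtype.ext
    (show (h * k : G) * a * (h * k : G)⁻¹ = h * (k * a * (k : G)⁻¹) * (h : G)⁻¹ by group)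

/-- The complex permutation module `ℂ[S]` afforded by the conjugation action of `K` on `S`. -/
def permRep {G : Type*} [Group G] (K : Subgroup G) (S : Set G)
    (hS : ∀ h ∈ K, ∀ a ∈ S, h * a * h⁻¹ ∈ S) : Representation ℂ K (MonoidAlgebra ℂ S) :=
  letI := conjActionOn K S hS
  Representation.ofMulAction ℂ K S

theorem gSet_zpow_conj {G : Type*} [Group G] (n : ℕ) (u g : G) (m : ℤ) :
    ∀ h ∈ pairCentralizer u g, ∀ a ∈ gSet n u (g ^ m), h * a * h⁻¹ ∈ gSet n u (g ^ m) := by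
  rintro h hh a ⟨h1, h2⟩
  have hu : Commute u h := Subgroup.mem_centralizer_iff.1 hh u (by simp)
  have hg : Commute g h := Subgroup.mem_centralizer_iff.1 hh g (by simp)
  have h3 : h * a * h⁻¹ * u⁻¹ = h * (a * u⁻¹) * h⁻¹ := by
    have : h⁻¹ * u⁻¹ = u⁻¹ * h⁻¹ := (hu.inv_inv).symm.eq
    simp only [mul_assoc, this]
  refine ⟨?_, ?_⟩
  · rw [h3, conj_pow, conj_pow, h1]
  · rw [conj_pow, h2, ← (hg.zpow_left m).eq, mul_inv_cancel_right]

theorem gSet_conj {G : Type*} [Group G] (n : ℕ) (u g : G) :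
    ∀ h ∈ pairCentralizer u g, ∀ a ∈ gSet n u g, h * a * h⁻¹ ∈ gSet n u g := by
  simpa using gSet_zpow_conj n u g 1

/-- `G` is an `FSZ⁺_n`-group: for all commuting `u, g ∈ G` and all integers `m` coprime to `|G|`,
the sets `G_n(u, g)` and `G_n(u, g^m)` afford isomorphic permutation modules for `C_G(u, g)`. -/
def IsFSZPlusN (n : ℕ) (G : Type*) [Group G] : Prop :=
  ∀ u g : G, Commute u g → ∀ m : ℤ, IsCoprime m (Nat.card G : ℤ) →
    Nonempty ((permRep (pairCentralizer u g) (gSet n u g) (gSet_conj n u g)).Equiv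
      (permRep (pairCentralizer u g) (gSet n u (g ^ m)) (gSet_zpow_conj n u g m)))

/-- `G` is an `FSZ⁺`-group: it is an `FSZ⁺_n`-group for every positive integer `n`. -/
def IsFSZPlus (G : Type*) [Group G] : Prop :=
  ∀ n : ℕ, 0 < n → IsFSZPlusN n G

/-- `G` is a (finite) dihedral group: it is isomorphic to the dihedral group of order `2n` for
some `n ≥ 1`. -/
def IsDihedral (G : Type*) [Group G] : Prop :=
  ∃ n : ℕ, 0 < n ∧ Nonempty (G ≃* DihedralGroup n)

end

/-!
The character of a representation of `D(G)` is a trace whose values on idempotents are natural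
numbers, and this is all that integrality of the indicators uses. For abelian `G` the algebra `D(G)`
is commutative, so the Sweedler power is multiplicative and maps the idempotent `Λ` to an
idempotent.

For the dihedral group of order `2k`, expand `2k Λ^[n]` in the elements `e g x` and let `C` be the
group of rotations. The terms with `g, x ∈ C` add up to `k` times the sum, over the `n`-torsion of
`C × Ĉ`, of the spectral idempotents of `C`. Conjugation by a reflection makes the value of `χ` on
them even in `p ∈ C × Ĉ`, so sums over subsets of `C × Ĉ` stable under `p ↦ -p` have the parity of
the sum over their elements of order at most two. For odd `n` this leaves only `p = 0`, and the
reflections contribute to `χ (Λ^[n])` exactly what they contribute to `χ Λ`, which is a natural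
number. For even `n` the rotation terms occur twice, over the `n`-torsion and over all of `C × Ĉ`,
with the same parity, and `χ (e (sr i) 1)` is invariant under `i ↦ i + 2`.

In `PSL₂(F)`, lifts to `SL₂(F)` of commuting elements commute or anticommute. Centralizers of
noncentral elements of `SL₂(F)` are abelian, since such a `2 × 2` matrix commutes only with linear
combinations of itself and `1`. If `A X = -X A ≠ X A`, then both traces vanish, so `X` and `A` are
involutions in `PSL₂(F)`; moreover `X` has distinct eigenvalues, and reading off the eigenvalue at a
fixed eigenvector embeds its centralizer in the units of a field, so this centralizer is cyclic. Its
image consists of the rotations, and the anticommuting elements are the reflections, of a dihedral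
group. Hence the centralizer of an element `g` of `PSL₂(F)` is abelian unless `g` is an involution.
In the first case `a ↦ a ^ m` is an equivariant bijection `G_n(u, g) → G_n(u, g ^ m)`, and in the
second case `g ^ m = g`.
-/

noncomputable section

/-- A linear functional on a complex algebra that behaves like the character of a
finite-dimensional representation: it is a trace, and its values on idempotents are natural numbers
(the ranks of the projections by which the idempotents act). -/
structure IsIntegralTrace {A : Type*} [Ring A] [Algebra ℂ A] (χ : A →ₗ[ℂ] ℂ) : Prop where
  map_mul_comm (a b : A) : χ (a * b) = χ (b * a)
  exists_natCast_eq {p : A} (hp : IsIdempotentElem p) : ∃ m : ℕ, (m : ℂ) = χ p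

namespace IsIntegralTrace

variable {A B : Type*} [Ring A] [Algebra ℂ A] [Ring B] [Algebra ℂ B]

theorem character (V : Type*) [AddCommGroup V] [Module ℂ V] [FiniteDimensional ℂ V] [Module A V]
    [IsScalarTower ℂ A V] :
    IsIntegralTrace
      (LinearMap.trace ℂ V ∘ₗ (Algebra.lsmul ℂ ℂ V : A →ₐ[ℂ] Module.End ℂ V).toLinearMap) where
  map_mul_comm a b := by
    simpa only [LinearMap.comp_apply, AlgHom.toLinearMap_apply, map_mul] using
      LinearMap.trace_mul_comm ℂ _ _
  exists_natCast_eq hp :=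
    ⟨_, (LinearMap.IsProj.trace
      (LinearMap.IsIdempotentElem.isProj_range _ (hp.map (Algebra.lsmul ℂ ℂ V)))).symm⟩

theorem comp {χ : B →ₗ[ℂ] ℂ} (hχ : IsIntegralTrace χ) (f : A →ₐ[ℂ] B) :
    IsIntegralTrace (χ ∘ₗ f.toLinearMap) where
  map_mul_comm a b := by
    simpa only [LinearMap.comp_apply, AlgHom.toLinearMap_apply, map_mul] using
      hχ.map_mul_comm _ _
  exists_natCast_eq hp := hχ.exists_natCast_eq (hp.map f)

end IsIntegralTrace

theorem sweedlerPow_mul {H : Type*} [Ring H] [HopfAlgebra ℂ H] [IsMulCommutative H] (n : ℕ)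
    (a b : H) : sweedlerPow H n (a * b) = sweedlerPow H n a * sweedlerPow H n b := by
  induction n generalizing a b with
  | zero =>
    simp only [sweedlerPow, LinearMap.comp_apply, Bialgebra.counit_mul, Algebra.linearMap_apply,
      map_mul]
  | succ n ih =>
    have mul'_lTensor_mul (s t : H ⊗[ℂ] H) :
        LinearMap.mul' ℂ H ((sweedlerPow H n).lTensor H (s * t)) =
          LinearMap.mul' ℂ H ((sweedlerPow H n).lTensor H s) *
            LinearMap.mul' ℂ H ((sweedlerPow H n).lTensor H t) := by
      induction s using TensorProduct.induction_on with
      | zero => simp only [zero_mul, map_zero]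
      | add s₁ s₂ h₁ h₂ => simp only [add_mul, map_add, h₁, h₂]
      | tmul x y =>
        induction t using TensorProduct.induction_on with
        | zero => simp only [mul_zero, map_zero]
        | add t₁ t₂ h₁ h₂ => simp only [mul_add, map_add, h₁, h₂]
        | tmul z w =>
          simp only [Algebra.TensorProduct.tmul_mul_tmul, LinearMap.lTensor_tmul,
            LinearMap.mul'_apply, ih, mul_assoc]
          rw [← mul_assoc z, mul_comm' z, mul_assoc]
    simp only [sweedlerPow, LinearMap.comp_apply, Bialgebra.comul_mul, mul'_lTensor_mul]

namespace DrinfeldDouble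

section Product

variable {G : Type*} [Group G]

theorem e_mul_e_of_commute {g x : G} (h : Commute x g) (y : G) :
    e g x * e g y = e g (x * y) := by
  rw [e_mul_e, if_pos (by rw [h.eq, mul_inv_cancel_right])]

theorem _root_.IsIntegralTrace.map_e_conj {χ : DrinfeldDouble G →ₗ[ℂ] ℂ} [Fintype G]
    (hχ : IsIntegralTrace χ) {g x : G} (hg : Commute x g) (h : G) :
    χ (e (h * g * h⁻¹) (h * x * h⁻¹)) = χ (e g x) := by
  have conj_eq : e (h * g * h⁻¹) (h * x * h⁻¹) = e (h * g * h⁻¹) h * e g (x * h⁻¹) := by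
    rw [e_mul_e, if_pos rfl, mul_assoc h x]
  have eq_conj : e g (x * h⁻¹) * e (h * g * h⁻¹) h = e g x := by
    have conj_of_conj : x * h⁻¹ * (h * g * h⁻¹) * (x * h⁻¹)⁻¹ = x * g * x⁻¹ := by group
    rw [e_mul_e, conj_of_conj, hg.eq, mul_inv_cancel_right, if_pos rfl, inv_mul_cancel_right]
  rw [conj_eq, hχ.map_mul_comm, eq_conj]

end Product

variable {G H : Type*} [Group G] [Group H] [Fintype G] [Fintype H]

theorem isIdempotentElem_integral : IsIdempotentElem (integral G) := by
  obtain ⟨mul_integral, -, counit_integral⟩ := integral_spec (G := G)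
  rw [IsIdempotentElem, mul_integral, counit_integral, one_smul]

instance (A : Type*) [CommGroup A] : IsMulCommutative (DrinfeldDouble A) := by
  classical
  refine .of_comm fun a b => ?_
  have mulHom_flip : (mulHom A).flip = mulHom A := by
    refine hom_ext fun g x => hom_ext fun h y => ?_
    simp only [LinearMap.flip_apply, mulHom_e, e_mul_e, mul_inv_cancel_comm, mul_comm y x,
      eq_comm (a := h)]
    split_ifs with hgh
    · rw [hgh]
    · rfl
  exact LinearMap.congr_fun₂ mulHom_flip b a

open Classical in
theorem sweedlerPow_e (n : ℕ) (g x : G) :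
    sweedlerPow (DrinfeldDouble G) n (e g x) =
      ∑ b : G, if (b * x⁻¹) ^ n * x ^ n = g then e b (x ^ n) else 0 := by
  induction n generalizing g with
  | zero =>
    simp only [sweedlerPow, LinearMap.comp_apply, counit_e, Algebra.linearMap_apply, pow_zero,
      mul_one, eq_comm (a := (1 : G))]
    split_ifs <;> simp [one_def]
  | succ n ih =>
    have pow_mul_pow (a : G) :
        (a * x⁻¹) ^ (n + 1) * x ^ (n + 1) = a * ((x⁻¹ * a) ^ n * x ^ n) := by
      have conj_pow_eq : (x⁻¹ * a) ^ n = x⁻¹ * (a * x⁻¹) ^ n * x := by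
        simpa only [inv_inv, mul_assoc, inv_mul_cancel, mul_one] using
          conj_pow (i := n) (a := x⁻¹) (b := a * x⁻¹)
      rw [conj_pow_eq, pow_succ' (a * x⁻¹), pow_succ' x]
      group
    simp only [sweedlerPow, LinearMap.comp_apply, comul_e, map_sum, LinearMap.lTensor_tmul,
      LinearMap.mul'_apply, ih, Finset.mul_sum, mul_ite, mul_zero, e_mul_e]
    refine Finset.sum_congr rfl fun a _ => ?_
    rw [Finset.sum_eq_single (x⁻¹ * a * x)]
    · rw [if_pos (show a = x * (x⁻¹ * a * x) * x⁻¹ by group), mul_inv_cancel_right, pow_mul_pow,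
        ← pow_succ' x]
      simp only [eq_inv_mul_iff_mul_eq]
    · intro b _ hb
      have not_conj : ¬ a = x * b * x⁻¹ := by
        rintro rfl
        exact hb (by group)
      rw [if_neg not_conj, ite_self]
    · simp only [Finset.mem_univ, not_true, false_implies]

open Classical in
theorem sweedlerPow_integral (n : ℕ) :
    sweedlerPow (DrinfeldDouble G) n (integral G) =
      (Fintype.card G : ℂ)⁻¹ •
        ∑ x : G, ∑ b : G, if (x * b⁻¹) ^ n = x ^ n then e b (x ^ n) else 0 := by
  have pow_mul_pow_eq_one (x b : G) :
      (b * x⁻¹) ^ n * x ^ n = 1 ↔ (x * b⁻¹) ^ n = x ^ n := by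
    rw [mul_eq_one_iff_inv_eq, ← inv_pow, mul_inv_rev, inv_inv]
  simp only [integral, map_smul, map_sum, sweedlerPow_e, pow_mul_pow_eq_one]

/-- The homomorphism of algebras `D(H) → D(G)` induced by a group isomorphism `H ≃* G`. -/
def mapAlgHom (φ : H ≃* G) : DrinfeldDouble H →ₐ[ℂ] DrinfeldDouble G :=
  let f : DrinfeldDouble H →ₗ[ℂ] DrinfeldDouble G :=
    (basis H).constr ℂ fun p => e (φ p.1) (φ p.2)
  have f_e (g x : H) : f (e g x) = e (φ g) (φ x) := (basis H).constr_basis ℂ _ (g, x)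
  .ofLinearMap f
    (by
      simp only [one_def, map_sum, f_e, map_one]
      exact Fintype.sum_equiv φ.toEquiv _ _ fun _ => rfl)
    (by
      classical
      have map_mul : (mulHom H).compr₂ f = (mulHom G).compl₁₂ f f := by
        refine hom_ext fun g x => hom_ext fun h y => ?_
        simp only [LinearMap.compr₂_apply, LinearMap.compl₁₂_apply, mulHom_e, e_mul_e,
          apply_ite f, f_e, map_zero, ← map_inv, ← map_mul, φ.injective.eq_iff]
      exact LinearMap.congr_fun₂ map_mul)

theorem mapAlgHom_e (φ : H ≃* G) (g x : H) : mapAlgHom φ (e g x) = e (φ g) (φ x) :=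
  (basis H).constr_basis ℂ _ (g, x)

theorem mapAlgHom_sweedlerPow_integral (φ : H ≃* G) (n : ℕ) :
    mapAlgHom φ (sweedlerPow (DrinfeldDouble H) n (integral H)) =
      sweedlerPow (DrinfeldDouble G) n (integral G) := by
  classical
  simp only [sweedlerPow_integral, map_smul, map_sum, Fintype.card_congr φ.toEquiv]
  congr 1
  refine Fintype.sum_equiv φ.toEquiv _ _ fun x => Fintype.sum_equiv φ.toEquiv _ _ fun b => ?_
  simp only [apply_ite (mapAlgHom φ), mapAlgHom_e, map_zero, MulEquiv.toEquiv_eq_coe,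
    MulEquiv.coe_toEquiv, ← map_inv, ← map_mul, ← map_pow, φ.injective.eq_iff]

end DrinfeldDouble

section FSZ

variable {G : Type*} [Group G] [Fintype G]

open DrinfeldDouble

theorem isFSZ_of_forall_isIntegralTrace
    (h : ∀ χ : DrinfeldDouble G →ₗ[ℂ] ℂ, IsIntegralTrace χ → ∀ n : ℕ, 0 < n →
      ∃ m : ℤ, χ (sweedlerPow (DrinfeldDouble G) n (integral G)) = m) : IsFSZ G :=
  fun n hn V => h _ (.character V) n hn

theorem isFSZ_of_commGroup (A : Type*) [CommGroup A] [Fintype A] : IsFSZ A := by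
  refine isFSZ_of_forall_isIntegralTrace fun χ hχ n _ => ?_
  have isIdempotentElem_sweedlerPow :
      IsIdempotentElem (sweedlerPow (DrinfeldDouble A) n (integral A)) := by
    rw [IsIdempotentElem, ← sweedlerPow_mul, isIdempotentElem_integral.eq]
  obtain ⟨m, hm⟩ := hχ.exists_natCast_eq isIdempotentElem_sweedlerPow
  exact ⟨m, by rw [← hm, Int.cast_natCast]⟩

end FSZ

theorem sweedlerPow_one {H : Type*} [Ring H] [HopfAlgebra ℂ H] (a : H) :
    sweedlerPow H 1 a = a := by
  simp only [sweedlerPow, LinearMap.comp_apply, LinearMap.lTensor_comp,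
    Coalgebra.lTensor_counit_comul, LinearMap.lTensor_tmul, Algebra.linearMap_apply, map_one,
    LinearMap.mul'_apply, mul_one]

section Parity

variable {A : Type*} [AddCommGroup A]

theorem even_sum_of_neg_ne_self {s : Finset A} {f : A → ℕ} (hf : ∀ a, f (-a) = f a)
    (neg_mem : ∀ a ∈ s, -a ∈ s) (neg_ne : ∀ a ∈ s, -a ≠ a) : Even (∑ a ∈ s, f a) := by
  rw [← ZMod.natCast_eq_zero_iff_even, Nat.cast_sum]
  refine Finset.sum_involution (fun a _ => -a) (fun a _ => ?_) (fun a ha _ => neg_ne a ha) neg_mem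
    fun a _ => neg_neg a
  rw [hf, CharTwo.add_self_eq_zero]

variable [Fintype A] [DecidableEq A]

theorem exists_sum_nsmul_eq_zero_of_odd {f : A → ℕ} (hf : ∀ a, f (-a) = f a) {n : ℕ}
    (hn : Odd n) : ∃ q, ∑ a with n • a = 0, f a = f 0 + 2 * q := by
  have even_sum : Even (∑ a ∈ ({a | n • a = 0} : Finset A).erase 0, f a) := by
    refine even_sum_of_neg_ne_self hf (by simp) fun a ha neg_eq => ?_
    rw [Finset.mem_erase, Finset.mem_filter_univ] at ha
    obtain ⟨c, rfl⟩ := hn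
    have two_nsmul_eq : 2 • a = 0 := by rw [two_nsmul, ← neg_eq_iff_add_eq_zero, neg_eq]
    rw [add_nsmul, mul_nsmul, two_nsmul_eq, nsmul_zero, zero_add, one_nsmul] at ha
    exact ha.1 ha.2
  obtain ⟨q, hq⟩ := even_iff_exists_two_mul.1 even_sum
  exact ⟨q, by rw [← hq, Finset.add_sum_erase _ _ (by simp)]⟩

theorem exists_sum_eq_sum_nsmul_eq_zero_of_even {f : A → ℕ} (hf : ∀ a, f (-a) = f a) {n : ℕ}
    (hn : Even n) : ∃ q, ∑ a, f a = ∑ a with n • a = 0, f a + 2 * q := by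
  have even_sum : Even (∑ a with ¬ n • a = 0, f a) := by
    refine even_sum_of_neg_ne_self hf (by simp) fun a ha neg_eq => ?_
    obtain ⟨c, rfl⟩ := hn
    have add_self_eq : a + a = 0 := by rw [← neg_eq_iff_add_eq_zero, neg_eq]
    rw [Finset.mem_filter_univ, add_nsmul, ← nsmul_add, add_self_eq, nsmul_zero] at ha
    exact ha rfl
  obtain ⟨q, hq⟩ := even_iff_exists_two_mul.1 even_sum
  exact ⟨q, by rw [← hq, Finset.sum_filter_add_sum_filter_not]⟩

end Parity

theorem card_nsmul_eq_zero_of_isAddCyclic {C : Type*} [AddCommGroup C] [IsAddCyclic C] [Fintype C]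
    [DecidableEq C] (n : ℕ) : Finset.card {c : C | n • c = 0} = (Nat.card C).gcd n := by
  rw [← IsAddCyclic.card_nsmulAddMonoidHom_ker C n, ← Nat.card_eq_finsetCard]
  exact Nat.card_congr (Equiv.subtypeEquivRight fun l => by simp)

section Periodic

variable {k : ℕ} [NeZero k]

theorem two_mul_sum_of_periodic_two {w : ZMod k → ℕ} (hw : Function.Periodic w 2) :
    2 * ∑ i, w i = k * (w 0 + w 1) := by
  have add_shift (i : ZMod k) : w i + w (i + 1) = w 0 + w 1 := by
    obtain ⟨j, rfl⟩ := ZMod.natCast_zmod_surjective i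
    induction j with
    | zero => simp
    | succ j ih => rw [← ih, Nat.cast_succ, add_assoc, one_add_one_eq_two, hw, add_comm]
  calc 2 * ∑ i, w i = ∑ i, w i + ∑ i, w (i + 1) := by
        rw [two_mul, Fintype.sum_equiv (Equiv.addRight 1) (fun i => w (i + 1)) w fun _ => rfl]
    _ = k * (w 0 + w 1) := by
        simp [← Finset.sum_add_distrib, add_shift]

theorem dvd_gcd_mul_sum_of_periodic_two {w : ZMod k → ℕ} (hw : Function.Periodic w 2) {n : ℕ}
    (hn : Even n) : k ∣ k.gcd n * ∑ i, w i := by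
  have dvd_two_mul_sum : k ∣ 2 * ∑ i, w i := ⟨_, two_mul_sum_of_periodic_two hw⟩
  rcases Nat.even_or_odd k with hk | hk
  · obtain ⟨d, hd⟩ := Nat.dvd_gcd hk.two_dvd hn.two_dvd
    rw [hd, mul_comm 2 d, mul_assoc]
    exact dvd_two_mul_sum.mul_left d
  · exact (Nat.Coprime.dvd_of_dvd_mul_left (Nat.coprime_two_right.2 hk) dvd_two_mul_sum).mul_left _

end Periodic

namespace DrinfeldDouble

section SpectralIdempotent

variable {G A : Type*} [Group G] [AddCommGroup A] [Fintype A]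

/-- The idempotent of `D(G)` attached to `g : G`, a homomorphism `c` from a finite abelian group `A`
to the centralizer of `g`, and a linear character `ψ` of `A`: it cuts out the `ψ`-isotypic part of
the degree `g` part of a representation of `D(G)`. -/
def spectralIdempotent (g : G) (c : AddChar A G) (ψ : AddChar A ℂ) : DrinfeldDouble G :=
  (Fintype.card A : ℂ)⁻¹ • ∑ a : A, ψ (-a) • e g (c a)

variable {g : G} {c : AddChar A G}

theorem sum_smul_spectralIdempotent (a : A) :
    ∑ ψ : AddChar A ℂ, ψ a • spectralIdempotent g c ψ = e g (c a) := by
  classical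
  have sum_characters (b : A) :
      ∑ ψ : AddChar A ℂ, ψ a * ψ (-b) = if a = b then (Fintype.card A : ℂ) else 0 := by
    simp only [← AddChar.map_add_eq_mul, AddChar.sum_apply_eq_ite, ← sub_eq_add_neg, sub_eq_zero]
  calc ∑ ψ : AddChar A ℂ, ψ a • spectralIdempotent g c ψ
      = (Fintype.card A : ℂ)⁻¹ • ∑ b : A, (∑ ψ : AddChar A ℂ, ψ a * ψ (-b)) • e g (c b) := by
        simp only [spectralIdempotent, Finset.smul_sum, smul_smul, Finset.sum_smul]
        rw [Finset.sum_comm]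
        simp only [mul_left_comm]
    _ = e g (c a) := by simp [sum_characters]

open Classical in
theorem sum_apply_e_pow (χ : DrinfeldDouble G →ₗ[ℂ] ℂ) (n : ℕ) :
    ∑ a, χ (e g (c a ^ n)) =
      Fintype.card A * ∑ ψ : AddChar A ℂ with n • ψ = 0, χ (spectralIdempotent g c ψ) := by
  calc ∑ a, χ (e g (c a ^ n))
      = ∑ a, ∑ ψ : AddChar A ℂ, (n • ψ) a * χ (spectralIdempotent g c ψ) := by
        simp only [← AddChar.map_nsmul_eq_pow, AddChar.nsmul_apply,
          ← sum_smul_spectralIdempotent (c := c), map_sum, map_smul, smul_eq_mul]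
    _ = Fintype.card A * ∑ ψ : AddChar A ℂ with n • ψ = 0, χ (spectralIdempotent g c ψ) := by
        rw [Finset.sum_comm]
        simp only [← Finset.sum_mul, AddChar.sum_eq_ite, ite_mul, zero_mul, mul_ite, mul_zero,
          Finset.mul_sum, Finset.sum_filter]

variable [Finite G]

theorem isIdempotentElem_spectralIdempotent (hc : ∀ a, Commute (c a) g) (ψ : AddChar A ℂ) :
    IsIdempotentElem (spectralIdempotent g c ψ) := by
  have := Fintype.ofFinite G
  have term_mul_term (a b : A) : (ψ (-a) • e g (c a)) * (ψ (-b) • e g (c b)) =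
      ψ (-(a + b)) • e g (c (a + b)) := by
    rw [smul_mul_smul_comm, e_mul_e_of_commute (hc a), neg_add, AddChar.map_add_eq_mul,
      AddChar.map_add_eq_mul]
  have sum_shift (a : A) : ∑ b, ψ (-(a + b)) • e g (c (a + b)) = ∑ b, ψ (-b) • e g (c b) :=
    Fintype.sum_equiv (Equiv.addLeft a) _ _ fun _ => rfl
  rw [IsIdempotentElem, spectralIdempotent, smul_mul_smul_comm, Finset.sum_mul_sum]
  simp only [term_mul_term, sum_shift]
  rw [Finset.sum_const, Finset.card_univ, ← Nat.cast_smul_eq_nsmul ℂ, smul_smul, mul_assoc,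
    inv_mul_cancel₀ (Nat.cast_ne_zero.2 Fintype.card_ne_zero), mul_one]

end SpectralIdempotent

end DrinfeldDouble

section DihedralGroup

open DihedralGroup

variable {k : ℕ}

theorem sr_pow_of_even (i : ZMod k) {n : ℕ} (hn : Even n) : sr i ^ n = 1 := by
  obtain ⟨m, rfl⟩ := hn
  rw [pow_add, ← (Commute.refl _).mul_pow, sr_mul_self, one_pow]

theorem sr_pow_of_odd (i : ZMod k) {n : ℕ} (hn : Odd n) : sr i ^ n = sr i := by
  obtain ⟨m, rfl⟩ := hn
  rw [pow_succ, sr_pow_of_even i (even_two_mul m), one_mul]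

section PowEqPow

variable (i l : ZMod k) {n : ℕ}

theorem r_mul_inv_r_pow_eq_iff : (r l * (r i)⁻¹) ^ n = r l ^ n ↔ n • i = 0 := by
  rw [inv_r, r_mul_r, r_pow, r_pow, r.injEq, add_mul, add_eq_left, neg_mul, neg_eq_zero,
    nsmul_eq_mul, mul_comm]

theorem r_mul_inv_sr_pow_eq_iff_of_even (hn : Even n) :
    (r l * (sr i)⁻¹) ^ n = r l ^ n ↔ n • l = 0 := by
  rw [inv_sr, r_mul_sr, sr_pow_of_even _ hn, r_pow, DihedralGroup.one_def, r.injEq,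
    eq_comm, nsmul_eq_mul, mul_comm]

theorem sr_mul_inv_r_pow_eq_of_even (hn : Even n) : (sr l * (r i)⁻¹) ^ n = sr l ^ n := by
  rw [inv_r, sr_mul_r, sr_pow_of_even _ hn, sr_pow_of_even _ hn]

theorem sr_mul_inv_sr_pow_eq_iff_of_even (hn : Even n) :
    (sr l * (sr i)⁻¹) ^ n = sr l ^ n ↔ n • (i - l) = 0 := by
  rw [inv_sr, sr_mul_sr, sr_pow_of_even _ hn, r_pow, DihedralGroup.one_def, r.injEq,
    nsmul_eq_mul, mul_comm]

theorem r_mul_inv_sr_pow_ne_of_odd (hn : Odd n) : (r l * (sr i)⁻¹) ^ n ≠ r l ^ n := by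
  rw [inv_sr, r_mul_sr, sr_pow_of_odd _ hn, r_pow]
  nofun

theorem sr_mul_inv_r_pow_eq_iff_of_odd (hn : Odd n) :
    (sr l * (r i)⁻¹) ^ n = sr l ^ n ↔ i = 0 := by
  rw [inv_r, sr_mul_r, sr_pow_of_odd _ hn, sr_pow_of_odd _ hn, sr.injEq, add_eq_left,
    neg_eq_zero]

theorem sr_mul_inv_sr_pow_ne_of_odd (hn : Odd n) : (sr l * (sr i)⁻¹) ^ n ≠ sr l ^ n := by
  rw [inv_sr, sr_mul_sr, sr_pow_of_odd _ hn, r_pow]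
  nofun

end PowEqPow

/-- The rotations `r : ZMod k → DihedralGroup k` as a homomorphism. -/
def dihedralRotation (k : ℕ) : AddChar (ZMod k) (DihedralGroup k) where
  toFun := r
  map_zero_eq_one' := r_zero
  map_add_eq_mul' i j := (r_mul_r i j).symm

theorem dihedralRotation_apply (i : ZMod k) : dihedralRotation k i = r i := rfl

theorem commute_r (i j : ZMod k) : Commute (r i) (r j) := by
  rw [Commute, SemiconjBy, r_mul_r, r_mul_r, add_comm]

variable [NeZero k]

theorem sum_dihedralGroup {M : Type*} [AddCommMonoid M] (f : DihedralGroup k → M) :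
    ∑ x, f x = ∑ i, f (r i) + ∑ i, f (sr i) := by
  rw [← Fintype.sum_equiv equivSum.symm (f ∘ equivSum.symm) f fun _ => rfl, Fintype.sum_sum_type]
  rfl

end DihedralGroup

namespace DrinfeldDouble

open DihedralGroup

section TraceFormula

variable {k : ℕ} [NeZero k] (χ : DrinfeldDouble (DihedralGroup k) →ₗ[ℂ] ℂ) {n : ℕ}

open Classical in
theorem two_mul_card_mul_apply_sweedlerPow_integral (n : ℕ) :
    2 * k * χ (sweedlerPow _ n (integral (DihedralGroup k))) =
      ∑ x : DihedralGroup k, ∑ b : DihedralGroup k,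
        if (x * b⁻¹) ^ n = x ^ n then χ (e b (x ^ n)) else 0 := by
  rw [sweedlerPow_integral, map_smul, smul_eq_mul, DihedralGroup.card, Nat.cast_mul,
    Nat.cast_ofNat, mul_inv_cancel_left₀ (by simp [NeZero.ne])]
  simp only [map_sum, apply_ite χ, map_zero]

/-- The idempotent of `D(DihedralGroup k)` attached to a rotation `r p.1` and a linear character
`p.2` of the group of rotations. -/
def rotationIdempotent (p : ZMod k × AddChar (ZMod k) ℂ) : DrinfeldDouble (DihedralGroup k) :=
  spectralIdempotent (r p.1) (dihedralRotation k) p.2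

open Classical in
theorem sum_apply_e_r_r_pow :
    (∑ l : ZMod k, ∑ i : ZMod k, if n • i = 0 then χ (e (r i) (r l ^ n)) else 0) =
      k * ∑ p with n • p = 0, χ (rotationIdempotent p) := by
  have sum_over_l (i : ZMod k) : ∑ l : ZMod k, χ (e (r i) (r l ^ n)) =
      k * ∑ ψ : AddChar (ZMod k) ℂ with n • ψ = 0, χ (rotationIdempotent (i, ψ)) := by
    simpa only [ZMod.card, dihedralRotation_apply, rotationIdempotent] using
      sum_apply_e_pow (g := r i) (c := dihedralRotation k) χ n
  have filter_prod : ({p | n • p = 0} : Finset (ZMod k × AddChar (ZMod k) ℂ)) =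
      ({i | n • i = 0} : Finset (ZMod k)) ×ˢ ({ψ | n • ψ = 0} : Finset (AddChar (ZMod k) ℂ)) := by
    ext p
    simp [Prod.ext_iff]
  rw [Finset.sum_comm, filter_prod, Finset.sum_product, Finset.mul_sum, Finset.sum_filter]
  refine Finset.sum_congr rfl fun i _ => ?_
  split_ifs
  · exact sum_over_l i
  · exact Finset.sum_const_zero

open Classical in
theorem apply_sweedlerPow_integral_of_odd (hn : Odd n) :
    2 * k * χ (sweedlerPow _ n (integral (DihedralGroup k))) =
      k * ∑ p with n • p = 0, χ (rotationIdempotent p) + ∑ l : ZMod k, χ (e 1 (sr l)) := by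
  simp only [two_mul_card_mul_apply_sweedlerPow_integral, sum_dihedralGroup,
    r_mul_inv_r_pow_eq_iff, r_mul_inv_sr_pow_ne_of_odd _ _ hn,
    sr_mul_inv_r_pow_eq_iff_of_odd _ _ hn, sr_mul_inv_sr_pow_ne_of_odd _ _ hn, if_false,
    Finset.sum_const_zero, add_zero, sum_apply_e_r_r_pow, Finset.sum_ite_eq', Finset.mem_univ,
    if_true]
  simp only [r_zero, sr_pow_of_odd _ hn]

open Classical in
theorem sum_apply_e_sr_r_pow :
    (∑ l : ZMod k, ∑ i : ZMod k, if n • l = 0 then χ (e (sr i) (r l ^ n)) else 0) =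
      k.gcd n * ∑ i : ZMod k, χ (e (sr i) 1) := by
  have eval_term (i l : ZMod k) : (if n • l = 0 then χ (e (sr i) (r l ^ n)) else 0) =
      if n • l = 0 then χ (e (sr i) 1) else 0 := by
    split_ifs with hl
    · rw [r_pow, mul_comm, ← nsmul_eq_mul, hl, r_zero]
    · rfl
  simp only [eval_term, Finset.sum_ite_irrel, Finset.sum_const_zero]
  rw [← Finset.sum_filter, Finset.sum_const, nsmul_eq_mul, card_nsmul_eq_zero_of_isAddCyclic,
    Nat.card_zmod]

open Classical in
theorem sum_apply_e_sr_sr_pow_of_even (hn : Even n) :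
    (∑ l : ZMod k, ∑ i : ZMod k, if n • (i - l) = 0 then χ (e (sr i) (sr l ^ n)) else 0) =
      k.gcd n * ∑ i : ZMod k, χ (e (sr i) 1) := by
  have card_shift (i : ZMod k) :
      Finset.card {l : ZMod k | n • (i - l) = 0} = Finset.card {l : ZMod k | n • l = 0} :=
    Finset.card_equiv (Equiv.subLeft i) (by simp)
  rw [Finset.sum_comm, Finset.mul_sum]
  refine Finset.sum_congr rfl fun i _ => ?_
  simp only [sr_pow_of_even _ hn]
  rw [← Finset.sum_filter, Finset.sum_const, nsmul_eq_mul, card_shift,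
    card_nsmul_eq_zero_of_isAddCyclic, Nat.card_zmod]

open Classical in
theorem apply_sweedlerPow_integral_of_even (hn : Even n) :
    2 * k * χ (sweedlerPow _ n (integral (DihedralGroup k))) =
      k * ∑ p with n • p = 0, χ (rotationIdempotent p) + k * ∑ p, χ (rotationIdempotent p) +
        2 * (k.gcd n * ∑ i : ZMod k, χ (e (sr i) 1)) := by
  have sum_sr_r : ∑ l : ZMod k, ∑ i : ZMod k, χ (e (r i) (sr l ^ n)) =
      k * ∑ p, χ (rotationIdempotent p) := by
    simpa [sr_pow_of_even _ hn] using sum_apply_e_r_r_pow χ (n := 0)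
  simp only [two_mul_card_mul_apply_sweedlerPow_integral, sum_dihedralGroup,
    r_mul_inv_r_pow_eq_iff, r_mul_inv_sr_pow_eq_iff_of_even _ _ hn,
    sr_mul_inv_r_pow_eq_of_even _ _ hn, sr_mul_inv_sr_pow_eq_iff_of_even _ _ hn, if_true,
    Finset.sum_add_distrib, sum_apply_e_r_r_pow, sum_apply_e_sr_r_pow, sum_sr_r,
    sum_apply_e_sr_sr_pow_of_even χ hn]
  ring

end TraceFormula

end DrinfeldDouble

namespace DrinfeldDouble

open DihedralGroup

section Integrality

variable {k : ℕ} [NeZero k] {χ : DrinfeldDouble (DihedralGroup k) →ₗ[ℂ] ℂ} {n : ℕ}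

theorem _root_.IsIntegralTrace.map_rotationIdempotent_neg (hχ : IsIntegralTrace χ)
    (p : ZMod k × AddChar (ZMod k) ℂ) :
    χ (rotationIdempotent (-p)) = χ (rotationIdempotent p) := by
  have conj_r (i : ZMod k) : sr 0 * r i * (sr 0)⁻¹ = r (-i) := by
    rw [inv_sr, sr_mul_r, sr_mul_sr, zero_add, zero_sub]
  have map_e_r_neg (i l : ZMod k) : χ (e (r (-i)) (r (-l))) = χ (e (r i) (r l)) := by
    rw [← conj_r, ← conj_r, hχ.map_e_conj (commute_r l i)]
  simp only [rotationIdempotent, spectralIdempotent, map_smul, map_sum, dihedralRotation_apply,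
    Prod.fst_neg, Prod.snd_neg]
  congr 1
  refine Fintype.sum_equiv (Equiv.neg _) _ _ fun l => ?_
  rw [Equiv.neg_apply, neg_neg, AddChar.neg_apply, neg_neg, ← map_e_r_neg, neg_neg]

theorem _root_.IsIntegralTrace.exists_rotation_multiplicity (hχ : IsIntegralTrace χ) :
    ∃ m : ZMod k × AddChar (ZMod k) ℂ → ℕ,
      (∀ p, χ (rotationIdempotent p) = m p) ∧ ∀ p, m (-p) = m p := by
  choose m hm using fun p : ZMod k × AddChar (ZMod k) ℂ => hχ.exists_natCast_eq
    (isIdempotentElem_spectralIdempotent (c := dihedralRotation k) (fun l => commute_r l p.1) p.2)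
  refine ⟨m, fun p => (hm p).symm, fun p => ?_⟩
  rw [← Nat.cast_inj (R := ℂ), hm, hm]
  exact hχ.map_rotationIdempotent_neg p

theorem _root_.IsIntegralTrace.exists_reflection_multiplicity (hχ : IsIntegralTrace χ) :
    ∃ w : ZMod k → ℕ, (∀ i, χ (e (sr i) 1) = w i) ∧ Function.Periodic w 2 := by
  have isIdempotentElem_e (i : ZMod k) : IsIdempotentElem (e (sr i) 1) := by
    rw [IsIdempotentElem, e_mul_e_of_commute (Commute.one_left _), mul_one]
  have conj_sr (i : ZMod k) : r (-1) * sr i * (r (-1))⁻¹ = sr (i + 2) := by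
    rw [inv_r, r_mul_sr, sr_mul_r]
    ring_nf
  choose w hw using fun i => hχ.exists_natCast_eq (isIdempotentElem_e i)
  refine ⟨w, fun i => (hw i).symm, fun i => ?_⟩
  rw [← Nat.cast_inj (R := ℂ), hw, hw, ← hχ.map_e_conj (Commute.one_left (sr i)) (r (-1)), conj_sr,
    mul_one, mul_inv_cancel]

theorem _root_.IsIntegralTrace.exists_intCast_eq_sweedlerPow_integral_of_odd
    (hχ : IsIntegralTrace χ) (hn : Odd n) :
    ∃ z : ℤ, χ (sweedlerPow _ n (integral (DihedralGroup k))) = z := by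
  classical
  obtain ⟨m, hm, m_neg⟩ := hχ.exists_rotation_multiplicity
  obtain ⟨N, hN⟩ := hχ.exists_natCast_eq isIdempotentElem_integral
  obtain ⟨q, hq⟩ := exists_sum_nsmul_eq_zero_of_odd m_neg hn
  have indicator_n := apply_sweedlerPow_integral_of_odd χ hn
  have indicator_one := apply_sweedlerPow_integral_of_odd χ odd_one
  simp only [hm, ← Nat.cast_sum, hq, one_nsmul, Finset.sum_filter, Finset.sum_ite_eq',
    Finset.mem_univ, if_true, sweedlerPow_one, ← hN] at indicator_n indicator_one
  refine ⟨N + q, mul_left_cancel₀ (mul_ne_zero two_ne_zero (NeZero.ne (k : ℂ))) ?_⟩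
  push_cast at indicator_n ⊢
  linear_combination indicator_n - indicator_one

theorem _root_.IsIntegralTrace.exists_intCast_eq_sweedlerPow_integral_of_even
    (hχ : IsIntegralTrace χ) (hn : Even n) :
    ∃ z : ℤ, χ (sweedlerPow _ n (integral (DihedralGroup k))) = z := by
  classical
  obtain ⟨m, hm, m_neg⟩ := hχ.exists_rotation_multiplicity
  obtain ⟨w, hw, w_periodic⟩ := hχ.exists_reflection_multiplicity
  obtain ⟨q, hq⟩ := exists_sum_eq_sum_nsmul_eq_zero_of_even m_neg hn
  obtain ⟨z, hz⟩ := dvd_gcd_mul_sum_of_periodic_two w_periodic hn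
  have indicator_n := apply_sweedlerPow_integral_of_even χ hn
  simp only [hm, hw, ← Nat.cast_sum, ← Nat.cast_mul, hq, hz] at indicator_n
  refine ⟨(∑ p with n • p = 0, m p : ℕ) + q + z,
    mul_left_cancel₀ (mul_ne_zero two_ne_zero (NeZero.ne (k : ℂ))) ?_⟩
  push_cast at indicator_n ⊢
  linear_combination indicator_n

end Integrality

end DrinfeldDouble

theorem isFSZ_of_isDihedral (D : Type*) [Group D] [Fintype D] (hD : IsDihedral D) :
    IsFSZ D := by
  obtain ⟨k, hk, ⟨φ⟩⟩ := hD
  have : NeZero k := ⟨hk.ne'⟩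
  refine isFSZ_of_forall_isIntegralTrace fun χ hχ n _ => ?_
  have hχφ := hχ.comp (DrinfeldDouble.mapAlgHom φ.symm)
  rw [← DrinfeldDouble.mapAlgHom_sweedlerPow_integral φ.symm n]
  rcases Nat.even_or_odd n with hn | hn
  · exact hχφ.exists_intCast_eq_sweedlerPow_integral_of_even hn
  · exact hχφ.exists_intCast_eq_sweedlerPow_integral_of_odd hn

section DihedralRecognition

variable {G : Type*} [Group G] {n : ℕ}

/-- The homomorphism `DihedralGroup n →* G` given by the images `c` of the rotations and the image
`s` of the reflection `DihedralGroup.sr 0`. -/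
def dihedralHom (c : AddChar (ZMod n) G) (s : G) (mul_self : s * s = 1)
    (map_mul_eq : ∀ i, c i * s = s * c (-i)) : DihedralGroup n →* G where
  toFun
    | .r i => c i
    | .sr i => s * c i
  map_one' := c.map_zero_eq_one
  map_mul' := by
    rintro (i | i) (j | j)
    · simp only [DihedralGroup.r_mul_r, c.map_add_eq_mul]
    · simp only [DihedralGroup.r_mul_sr]
      rw [← mul_assoc, map_mul_eq, mul_assoc, ← c.map_add_eq_mul, sub_eq_neg_add]
    · simp only [DihedralGroup.sr_mul_r, c.map_add_eq_mul, mul_assoc]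
    · simp only [DihedralGroup.sr_mul_sr]
      rw [mul_assoc, ← mul_assoc (c i), map_mul_eq, mul_assoc, ← c.map_add_eq_mul, ← mul_assoc,
        mul_self, one_mul, sub_eq_neg_add]

variable {c : AddChar (ZMod n) G} {s : G} {mul_self : s * s = 1}
  {map_mul_eq : ∀ i, c i * s = s * c (-i)}

theorem dihedralHom_r (i : ZMod n) : dihedralHom c s mul_self map_mul_eq (.r i) = c i := rfl

theorem dihedralHom_sr (i : ZMod n) : dihedralHom c s mul_self map_mul_eq (.sr i) = s * c i := rfl

theorem dihedralHom_injective (c_injective : Function.Injective c) (hs : s ∉ Set.range c) :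
    Function.Injective (dihedralHom c s mul_self map_mul_eq) := by
  rw [injective_iff_map_eq_one]
  rintro (i | i) hi
  · rw [dihedralHom_r, ← c.map_zero_eq_one] at hi
    rw [c_injective hi, DihedralGroup.r_zero]
  · rw [dihedralHom_sr, mul_eq_one_iff_eq_inv, ← c.map_neg_eq_inv] at hi
    exact absurd ⟨-i, hi.symm⟩ hs

theorem dihedralHom_surjective (h : ∀ g, g ∈ Set.range c ∨ s * g ∈ Set.range c) :
    Function.Surjective (dihedralHom c s mul_self map_mul_eq) := by
  intro g
  rcases h g with ⟨i, hi⟩ | ⟨i, hi⟩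
  · exact ⟨.r i, hi⟩
  · exact ⟨.sr i, by rw [dihedralHom_sr, hi, ← mul_assoc, mul_self, one_mul]⟩

theorem isDihedral_of_isCyclic_of_index_eq_two (N : Subgroup G) [IsCyclic N] [Finite N]
    (index_eq : N.index = 2) (mul_self : ∀ g ∉ N, g * g = 1) : IsDihedral G := by
  obtain ⟨s, hs⟩ : ∃ s, s ∉ N := by
    by_contra! h
    rw [Subgroup.index_eq_one.2 ((Subgroup.eq_top_iff' N).2 h)] at index_eq
    norm_num at index_eq
  let ψ : Multiplicative (ZMod (Nat.card N)) ≃* N := zmodCyclicMulEquiv inferInstance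
  let c : AddChar (ZMod (Nat.card N)) G :=
    AddChar.toMonoidHomEquiv.symm (N.subtype.comp ψ.toMonoidHom)
  have range_c : Set.range c = N :=
    ((ψ.surjective.comp Multiplicative.ofAdd.surjective).range_comp Subtype.val).trans
      Subtype.range_coe
  have c_injective : Function.Injective c :=
    Subtype.val_injective.comp (ψ.injective.comp Multiplicative.ofAdd.injective)
  have map_mul_eq (i : ZMod (Nat.card N)) : c i * s = s * c (-i) := by
    have c_mem : c (-i) ∈ N := (ψ _).2
    have := mul_self (s * c (-i)) fun h => hs ((Subgroup.mul_mem_cancel_right N c_mem).1 h)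
    rw [mul_eq_one_iff_eq_inv, mul_inv_rev, ← c.map_neg_eq_inv, neg_neg,
      inv_eq_of_mul_eq_one_left (mul_self s hs)] at this
    exact this.symm
  have bijective : Function.Bijective (dihedralHom c s (mul_self s hs) map_mul_eq) := by
    refine ⟨dihedralHom_injective c_injective (by rwa [range_c]),
      dihedralHom_surjective fun g => ?_⟩
    rw [range_c, SetLike.mem_coe, SetLike.mem_coe, Subgroup.mul_mem_iff_of_index_two index_eq]
    tauto
  exact ⟨Nat.card N, Nat.card_pos, ⟨(MulEquiv.ofBijective _ bijective).symm⟩⟩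

end DihedralRecognition

section FSZPlus

variable {G : Type*} [Group G]

theorem nonempty_permRep_equiv_of_conj_equivariant (K : Subgroup G) {S T : Set G}
    (hS : ∀ h ∈ K, ∀ a ∈ S, h * a * h⁻¹ ∈ S) (hT : ∀ h ∈ K, ∀ a ∈ T, h * a * h⁻¹ ∈ T) (ε : S ≃ T)
    (hε : ∀ h (hh : h ∈ K) (a : S), (ε ⟨h * a * h⁻¹, hS h hh a a.2⟩ : G) = h * ε a * h⁻¹) :
    Nonempty ((permRep K S hS).Equiv (permRep K T hT)) := by
  refine ⟨.mk (MonoidAlgebra.mapDomainLinearEquiv ℂ ℂ ε) fun g => ?_⟩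
  refine MonoidAlgebra.lhom_ext' fun a => LinearMap.ext fun c => ?_
  let := conjActionOn K S hS
  let := conjActionOn K T hT
  simp only [permRep, LinearMap.comp_apply, LinearEquiv.coe_coe, MonoidAlgebra.lsingle_apply,
    Representation.ofMulAction_single, MonoidAlgebra.mapDomainLinearEquiv_single]
  exact congrArg (MonoidAlgebra.single · c) (Subtype.ext (hε g g.2 a))

theorem zpow_mem_gSet {n : ℕ} {u g a : G} (ha : a ∈ gSet n u g) (hau : Commute a u) (m : ℤ) :
    a ^ m ∈ gSet n u (g ^ m) := by
  obtain ⟨mul_inv_pow_eq, rfl⟩ := ha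
  have u_pow : u ^ n = 1 := by
    rwa [hau.inv_right.mul_pow, mul_eq_left, inv_pow, inv_eq_one] at mul_inv_pow_eq
  refine ⟨?_, ?_⟩
  · rw [(hau.zpow_left m).inv_right.mul_pow, inv_pow, u_pow, inv_one, mul_one]
  · rw [← zpow_natCast, ← zpow_natCast, zpow_comm]

theorem exists_zpow_zpow_eq_self {m : ℤ} (hm : IsCoprime m (Nat.card G)) :
    ∃ m' : ℤ, ∀ a : G, (a ^ m) ^ m' = a := by
  obtain ⟨m', c, bezout⟩ := hm
  refine ⟨m', fun a => ?_⟩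
  rw [← zpow_mul, show m * m' = 1 - Nat.card G * c by linear_combination bezout, zpow_sub,
    zpow_one, zpow_mul, zpow_natCast, pow_card_eq_one', one_zpow, inv_one, mul_one]

theorem zpow_eq_self_of_sq_eq_one {m : ℤ} (hm : IsCoprime m (Nat.card G)) {g : G}
    (hg : g ^ 2 = 1) : g ^ m = g := by
  by_cases g_eq : g = 1
  · rw [g_eq, one_zpow]
  have two_dvd : (2 : ℤ) ∣ Nat.card G := by
    exact_mod_cast orderOf_eq_prime hg g_eq ▸ orderOf_dvd_natCard g
  obtain ⟨c, rfl⟩ := Int.isCoprime_two_right.1 (hm.of_isCoprime_of_dvd_right two_dvd)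
  rw [zpow_add, zpow_mul, zpow_ofNat, hg, one_zpow, one_mul, zpow_one]

theorem isFSZPlus_of_sq_eq_one_or_isMulCommutative_centralizer
    (h : ∀ g : G, g ^ 2 = 1 ∨ IsMulCommutative (Subgroup.centralizer {g})) : IsFSZPlus G := by
  intro n _ u g hug m hm
  rcases h g with g_sq | _
  · exact nonempty_permRep_equiv_of_conj_equivariant _ _ _
      (Equiv.setCongr (by rw [zpow_eq_self_of_sq_eq_one hm g_sq])) fun _ _ _ => rfl
  obtain ⟨m', zpow_zpow⟩ := exists_zpow_zpow_eq_self hm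
  have commute_of_commute {a b : G} (ha : Commute a g) (hb : Commute b g) : Commute a b :=
    congrArg Subtype.val (mul_comm' (⟨a, Subgroup.mem_centralizer_singleton_iff.2 ha⟩ :
      Subgroup.centralizer {g}) ⟨b, Subgroup.mem_centralizer_singleton_iff.2 hb⟩)
  have commute_u {a : G} (ha : a ∈ gSet n u g) : Commute a u :=
    commute_of_commute (ha.2 ▸ Commute.self_pow a n) hug
  have commute_u' {a : G} (ha : a ∈ gSet n u (g ^ m)) : Commute a u := by
    have commute_g : Commute a ((g ^ m) ^ m') := (ha.2 ▸ Commute.self_pow a n).zpow_right m'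
    exact commute_of_commute (zpow_zpow g ▸ commute_g) hug
  refine nonempty_permRep_equiv_of_conj_equivariant _ _ _
    { toFun := fun a => ⟨a ^ m, zpow_mem_gSet a.2 (commute_u a.2) m⟩
      invFun := fun a => ⟨a ^ m', by
        simpa only [zpow_zpow] using zpow_mem_gSet a.2 (commute_u' a.2) m'⟩
      left_inv := fun a => Subtype.ext (zpow_zpow a)
      right_inv := fun a => Subtype.ext ((zpow_comm _ _ _).trans (zpow_zpow a)) }
    fun k _ a => conj_zpow

end FSZPlus

section Matrix

open Matrix

theorem exists_monoidHom_apply_eq_smul {M K V : Type*} [Monoid M] [Field K] [AddCommGroup V]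
    [Module K V] (ρ : M →* Module.End K V) {v : V} (hv : v ≠ 0) (h : ∀ m, ∃ μ : K, ρ m v = μ • v) :
    ∃ χ : M →* K, ∀ m, ρ m v = χ m • v := by
  choose χ hχ using h
  refine ⟨⟨⟨χ, ?_⟩, fun m m' => ?_⟩, hχ⟩
  · apply smul_left_injective K hv
    simp only [← hχ, map_one, Module.End.one_apply, one_smul]
  · apply smul_left_injective K hv
    simp only [← hχ, map_mul, Module.End.mul_apply]
    rw [hχ m', map_smul, hχ m, smul_smul, mul_comm]

theorem two_mul_trace_eq_zero_of_mul_eq_neg_mul {n R : Type*} [Fintype n] [DecidableEq n]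
    [CommRing R] {A X : Matrix n n R} (hA : IsUnit A) (h : A * X = -(X * A)) : 2 * X.trace = 0 := by
  obtain ⟨A, rfl⟩ := hA
  have trace_eq : X.trace = -X.trace := calc
    X.trace = (A.1 * X * A.inv).trace := by
      rw [trace_mul_comm, ← mul_assoc, A.inv_val, one_mul]
    _ = -X.trace := by rw [h, neg_mul, trace_neg, mul_assoc, A.val_inv, mul_one]
  linear_combination trace_eq

theorem det_sub_one_fin_two {R : Type*} [CommRing R] (A : Matrix (Fin 2) (Fin 2) R) :
    (A - 1).det = A.det - A.trace + 1 := by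
  simp only [det_fin_two, trace_fin_two, Matrix.sub_apply, one_apply_eq,
    one_apply_ne zero_ne_one, one_apply_ne one_ne_zero, sub_zero]
  ring

variable {F : Type*} [Field F] {X Y Z : Matrix (Fin 2) (Fin 2) F}

theorem exists_eq_smul_one_add_smul_of_commute (hX : X ∉ Set.range (scalar (Fin 2)))
    (h : Commute Y X) : ∃ a b : F, Y = a • 1 + b • X := by
  have mul_eq := h.eq
  simp only [← Matrix.ext_iff, Fin.forall_fin_two, Matrix.mul_apply, Fin.sum_univ_two] at mul_eq
  obtain ⟨⟨h₀₀, h₀₁⟩, h₁₀, -⟩ := mul_eq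
  suffices ∃ b, Y 0 1 = b * X 0 1 ∧ Y 1 0 = b * X 1 0 ∧ Y 1 1 = Y 0 0 - b * X 0 0 + b * X 1 1 by
    obtain ⟨b, h₁, h₂, h₃⟩ := this
    refine ⟨Y 0 0 - b * X 0 0, b, ?_⟩
    ext i j
    fin_cases i <;> fin_cases j <;> simp [h₁, h₂, h₃]
  by_cases x₀₁ : X 0 1 = 0
  · by_cases x₁₀ : X 1 0 = 0
    · have x_sub : X 0 0 - X 1 1 ≠ 0 := by
        refine fun x_sub => hX ⟨X 0 0, ?_⟩
        ext i j
        fin_cases i <;> fin_cases j <;> simp [x₀₁, x₁₀, sub_eq_zero.1 x_sub]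
      refine ⟨(Y 0 0 - Y 1 1) / (X 0 0 - X 1 1), ?_, ?_, ?_⟩ <;> grind
    · refine ⟨Y 1 0 / X 1 0, ?_, ?_, ?_⟩ <;> grind
  · refine ⟨Y 0 1 / X 0 1, ?_, ?_, ?_⟩ <;> grind

theorem commute_of_commute_of_notMem_range_scalar (hX : X ∉ Set.range (scalar (Fin 2)))
    (hY : Commute Y X) (hZ : Commute Z X) : Commute Y Z := by
  obtain ⟨a, b, rfl⟩ := exists_eq_smul_one_add_smul_of_commute hX hY
  exact (((Commute.one_left Z).smul_left a).add_left (hZ.symm.smul_left b))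

end Matrix

section SpecialLinearGroup

open scoped MatrixGroups Matrix

theorem coe_mem_range_scalar_iff_mem_center {n R : Type*} [Fintype n] [DecidableEq n] [CommRing R]
    {X : Matrix.SpecialLinearGroup n R} :
    (X : Matrix n n R) ∈ Set.range (Matrix.scalar n) ↔
      X ∈ Subgroup.center (Matrix.SpecialLinearGroup n R) := by
  refine ⟨fun ⟨r, hr⟩ => Matrix.SpecialLinearGroup.mem_center_iff.2 ⟨r, ?_, hr⟩, fun hX => ?_⟩
  · rw [← X.det_coe, ← hr, Matrix.scalar_apply, Matrix.det_diagonal, Finset.prod_const,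
      Finset.card_univ]
  · obtain ⟨r, -, hr⟩ := Matrix.SpecialLinearGroup.mem_center_iff.1 hX
    exact ⟨r, hr⟩

theorem two_mul_trace_coe_eq_zero_of_mul_eq_neg_mul {R : Type*} [CommRing R] {A X : SL(2, R)}
    (h : A * X = -(X * A)) : 2 * X.1.trace = 0 :=
  two_mul_trace_eq_zero_of_mul_eq_neg_mul
    ((Group.isUnit A).map Matrix.SpecialLinearGroup.coeMonoidHom) (congrArg Subtype.val h)

theorem commute_of_mul_eq_neg_mul_of_two_eq_zero {R : Type*} [CommRing R] {A X : SL(2, R)}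
    (two_eq : (2 : R) = 0) (h : A * X = -(X * A)) : Commute A X := by
  have add_self_eq : (X * A).1 + (X * A).1 = 0 := by rw [← two_smul R, two_eq, zero_smul]
  exact h.trans (Subtype.ext (neg_eq_of_add_eq_zero_left add_self_eq))

theorem mul_self_eq_neg_one_of_trace_eq_zero {R : Type*} [CommRing R] {X : SL(2, R)}
    (hX : X.1.trace = 0) : X * X = -1 := by
  cases subsingleton_or_nontrivial R
  · exact Subtype.ext (Subsingleton.elim _ _)
  have cayley_hamilton := Matrix.aeval_self_charpoly X.1
  rw [Matrix.charpoly_fin_two, hX, X.det_coe] at cayley_hamilton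
  simp only [map_zero, zero_mul, sub_zero, map_one, map_add, map_pow, Polynomial.aeval_X]
    at cayley_hamilton
  exact Subtype.ext ((sq X.1).symm.trans (eq_neg_of_add_eq_zero_left cayley_hamilton))

theorem trace_sq_eq_four_of_mem_center {R : Type*} [CommRing R] {X : SL(2, R)}
    (hX : X ∈ Subgroup.center SL(2, R)) : X.1.trace ^ 2 = 4 := by
  obtain ⟨r, r_sq, hr⟩ := Matrix.SpecialLinearGroup.mem_center_iff.1 hX
  rw [Fintype.card_fin] at r_sq
  rw [← hr, Matrix.scalar_apply, Matrix.trace_diagonal, Fin.sum_univ_two]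
  linear_combination 4 * r_sq

variable {F : Type*} [Field F] {A B X : SL(2, F)}

theorem commute_of_commute_of_notMem_center (hX : X ∉ Subgroup.center SL(2, F))
    (hA : Commute A X) (hB : Commute B X) : Commute A B :=
  Subtype.ext (commute_of_commute_of_notMem_range_scalar
    (coe_mem_range_scalar_iff_mem_center.not.2 hX) (congrArg Subtype.val hA)
    (congrArg Subtype.val hB))

theorem exists_coe_eq_smul_one_add_smul_of_commute (hX : X ∉ Subgroup.center SL(2, F))
    (hA : Commute A X) : ∃ a b : F, A.1 = a • 1 + b • X.1 :=
  exists_eq_smul_one_add_smul_of_commute (coe_mem_range_scalar_iff_mem_center.not.2 hX)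
    (congrArg Subtype.val hA)

theorem eq_one_of_commute_of_trace_eq_two (hX : X.1.trace ^ 2 ≠ 4) (hA : Commute A X)
    (trace_eq : A.1.trace = 2) : A = 1 := by
  obtain ⟨a, b, A_eq⟩ := exists_coe_eq_smul_one_add_smul_of_commute
    (mt trace_sq_eq_four_of_mem_center hX) hA
  have det_A := A.det_coe
  have det_X := X.det_coe
  simp only [A_eq, Matrix.det_fin_two, Matrix.trace_fin_two, Matrix.add_apply, Matrix.smul_apply,
    Matrix.one_apply, smul_eq_mul, Fin.isValue, zero_ne_one, one_ne_zero, if_true, if_false,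
    mul_one, mul_zero, zero_add]
    at det_A det_X trace_eq hX
  have b_eq : b = 0 := by
    have : b ^ 2 * ((X.1 0 0 + X.1 1 1) ^ 2 - 4) = 0 := by
      linear_combination (2 * a + b * (X.1 0 0 + X.1 1 1) + 2) * trace_eq - 4 * det_A
        + 4 * b ^ 2 * det_X
    exact pow_eq_zero_iff two_ne_zero |>.1 ((mul_eq_zero.1 this).resolve_right (sub_ne_zero.2 hX))
  have a_eq : a = 1 := by
    have : (a - 1) ^ 2 = 0 := by
      rw [b_eq] at det_A trace_eq
      linear_combination det_A - trace_eq
    exact sub_eq_zero.1 (pow_eq_zero_iff two_ne_zero |>.1 this)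
  exact Subtype.ext (by
    rw [A_eq, a_eq, b_eq, one_smul, zero_smul, add_zero, Matrix.SpecialLinearGroup.coe_one])

theorem exists_monoidHom_centralizer_mulVec_eq_smul (K : Type*) [Field K] [IsAlgClosed K]
    [Algebra F K] (hX : X ∉ Subgroup.center SL(2, F)) :
    ∃ v : Fin 2 → K, v ≠ 0 ∧ ∃ χ : Subgroup.centralizer {X} →* K,
      ∀ A, (Algebra.ofId F K).mapMatrix A.1.1 *ᵥ v = χ A • v := by
  let ρ : Subgroup.centralizer {X} →* Module.End K (Fin 2 → K) :=
    .comp (Matrix.toLinAlgEquiv' : _ ≃ₐ[K] Module.End K (Fin 2 → K)) <|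
      .comp ((Algebra.ofId F K).mapMatrix : Matrix (Fin 2) (Fin 2) F →ₐ[F] _).toMonoidHom <|
        Matrix.SpecialLinearGroup.coeMonoidHom.comp (Subgroup.subtype _)
  obtain ⟨μ, hμ⟩ :=
    Module.End.exists_eigenvalue (Matrix.toLinAlgEquiv' ((Algebra.ofId F K).mapMatrix X.1))
  obtain ⟨v, hv⟩ := hμ.exists_hasEigenvector
  refine ⟨v, hv.2, exists_monoidHom_apply_eq_smul ρ hv.2 fun A => ?_⟩
  obtain ⟨a, b, A_eq⟩ := exists_coe_eq_smul_one_add_smul_of_commute hX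
    (Subgroup.mem_centralizer_singleton_iff.1 A.2)
  refine ⟨a • 1 + b • μ, ?_⟩
  calc
    ρ A v = (Algebra.ofId F K).mapMatrix (a • 1 + b • X.1) *ᵥ v := by rw [← A_eq]; rfl
    _ = a • v + b • ((Algebra.ofId F K).mapMatrix X.1 *ᵥ v) := by
      rw [map_add, map_smul, map_smul, map_one, Matrix.add_mulVec, Matrix.smul_mulVec,
        Matrix.smul_mulVec, Matrix.one_mulVec]
    _ = (a • 1 + b • μ) • v := by
      rw [show (Algebra.ofId F K).mapMatrix X.1 *ᵥ v = μ • v from hv.apply_eq_smul, add_smul,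
        smul_assoc, smul_assoc, one_smul]

theorem isCyclic_centralizer_of_trace_sq_ne_four [Finite F] (hX : X.1.trace ^ 2 ≠ 4) :
    IsCyclic (Subgroup.centralizer {X}) := by
  obtain ⟨v, v_ne_zero, χ, hχ⟩ := exists_monoidHom_centralizer_mulVec_eq_smul (AlgebraicClosure F)
    (mt trace_sq_eq_four_of_mem_center hX)
  refine isCyclic_of_injective_ringHom χ ((injective_iff_map_eq_one χ).2 fun A hA => ?_)
  refine Subtype.ext (eq_one_of_commute_of_trace_eq_two hX
    (Subgroup.mem_centralizer_singleton_iff.1 A.2) ?_)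
  have det_eq : (A.1.1 - 1).det = 0 := by
    rw [← map_eq_zero_iff (Algebra.ofId F (AlgebraicClosure F)) (RingHom.injective _),
      AlgHom.map_det, ← Matrix.exists_mulVec_eq_zero_iff]
    exact ⟨v, v_ne_zero, by
      rw [map_sub, map_one, Matrix.sub_mulVec, Matrix.one_mulVec, hχ, hA, one_smul, sub_self]⟩
  rw [det_sub_one_fin_two, A.1.det_coe] at det_eq
  linear_combination -det_eq

end SpecialLinearGroup

section ProjectiveSpecialLinearGroup

open scoped MatrixGroups

/-- The projection `SL(n, R) → PSL(n, R)`. -/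
def toPSL (n : ℕ) (R : Type*) [CommRing R] : SL(n, R) →* PSL(n, R) :=
  QuotientGroup.mk' _

theorem toPSL_surjective (n : ℕ) (R : Type*) [CommRing R] : Function.Surjective (toPSL n R) :=
  QuotientGroup.mk'_surjective _

section IsDomain

variable {R : Type*} [CommRing R] [IsDomain R] {A B X : SL(2, R)}

theorem toPSL_eq_one_iff : toPSL 2 R A = 1 ↔ A = 1 ∨ A = -1 := by
  rw [← MonoidHom.mem_ker, toPSL, QuotientGroup.ker_mk', Matrix.SpecialLinearGroup.mem_center_iff]
  simp only [Fintype.card_fin, sq_eq_one_iff, or_and_right, exists_or, exists_eq_left, map_one,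
    map_neg, eq_comm (b := A.1)]
  have coe_injective := Matrix.SpecialLinearGroup.coeMonoidHom_injective (ι := Fin 2) (R := R)
  exact or_congr (coe_injective.eq_iff (b := 1)) (coe_injective.eq_iff (b := -1))

theorem toPSL_eq_toPSL_iff : toPSL 2 R A = toPSL 2 R B ↔ A = B ∨ A = -B := by
  rw [← mul_inv_eq_one, ← map_inv, ← map_mul, toPSL_eq_one_iff, mul_inv_eq_one,
    mul_inv_eq_iff_eq_mul, neg_one_mul]

theorem commute_toPSL_iff :
    Commute (toPSL 2 R A) (toPSL 2 R B) ↔ Commute A B ∨ A * B = -(B * A) := by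
  rw [Commute, SemiconjBy, ← map_mul, ← map_mul, toPSL_eq_toPSL_iff, Commute, SemiconjBy]

theorem toPSL_mem_centralizer_iff :
    toPSL 2 R A ∈ Subgroup.centralizer {toPSL 2 R X} ↔ Commute A X ∨ A * X = -(X * A) :=
  Subgroup.mem_centralizer_singleton_iff.trans commute_toPSL_iff

theorem toPSL_mem_map_centralizer_iff :
    toPSL 2 R A ∈ (Subgroup.centralizer {X}).map (toPSL 2 R) ↔ Commute A X := by
  refine ⟨?_, fun h => ⟨A, Subgroup.mem_centralizer_singleton_iff.2 h, rfl⟩⟩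
  rintro ⟨B, hB, B_eq⟩
  have commute_B : Commute B X := Subgroup.mem_centralizer_singleton_iff.1 hB
  rcases toPSL_eq_toPSL_iff.1 B_eq with h | h
  · rwa [← h]
  · exact (neg_eq_iff_eq_neg.2 h) ▸ commute_B.neg_left

theorem index_map_centralizer_subgroupOf {S : SL(2, R)} (hS : S * X = -(X * S))
    (not_commute : ¬Commute S X) :
    (((Subgroup.centralizer {X}).map (toPSL 2 R)).subgroupOf
      (Subgroup.centralizer {toPSL 2 R X})).index = 2 := by
  refine Subgroup.index_eq_two_iff_exists_notMem_and.2
    ⟨⟨toPSL 2 R S, toPSL_mem_centralizer_iff.2 (.inr hS)⟩,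
      toPSL_mem_map_centralizer_iff.not.2 not_commute, ?_⟩
  rintro ⟨b, hb⟩
  obtain ⟨B, rfl⟩ := toPSL_surjective 2 R b
  refine (toPSL_mem_centralizer_iff.1 hb).symm.imp (fun hB => ?_) toPSL_mem_map_centralizer_iff.2
  refine toPSL_mem_map_centralizer_iff (A := B * S) |>.2 ?_
  rw [Commute, SemiconjBy, mul_assoc, hS, mul_neg, ← mul_assoc, hB, neg_mul, neg_neg, mul_assoc]

theorem toPSL_sq_eq_one_of_trace_eq_zero (hX : X.1.trace = 0) : toPSL 2 R X ^ 2 = 1 := by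
  rw [← map_pow, sq, mul_self_eq_neg_one_of_trace_eq_zero hX]
  exact toPSL_eq_one_iff.2 (.inr rfl)

end IsDomain

variable {F : Type*} [Field F] {X : SL(2, F)}

theorem isMulCommutative_centralizer_toPSL (hX : toPSL 2 F X ≠ 1)
    (h : ∀ A : SL(2, F), A * X = -(X * A) → Commute A X) :
    IsMulCommutative (Subgroup.centralizer {toPSL 2 F X}) := by
  have commute_of_mem (A : SL(2, F)) (hA : toPSL 2 F A ∈ Subgroup.centralizer {toPSL 2 F X}) :
      Commute A X :=
    (toPSL_mem_centralizer_iff.1 hA).elim id (h A)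
  refine ⟨⟨?_⟩⟩
  rintro ⟨a, ha⟩ ⟨b, hb⟩
  obtain ⟨A, rfl⟩ := toPSL_surjective 2 F a
  obtain ⟨B, rfl⟩ := toPSL_surjective 2 F b
  exact Subtype.ext ((commute_of_commute_of_notMem_center ((QuotientGroup.eq_one_iff X).not.1 hX)
    (commute_of_mem A ha) (commute_of_mem B hb)).map (toPSL 2 F))

theorem isDihedral_centralizer_toPSL [Finite F] {S : SL(2, F)} (hS : S * X = -(X * S))
    (not_commute : ¬Commute S X) : IsDihedral (Subgroup.centralizer {toPSL 2 F X}) := by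
  have two_ne : (2 : F) ≠ 0 := fun h => not_commute (commute_of_mul_eq_neg_mul_of_two_eq_zero h hS)
  have trace_eq_zero {A B : SL(2, F)} (h : A * B = -(B * A)) : B.1.trace = 0 :=
    (mul_eq_zero.1 (two_mul_trace_coe_eq_zero_of_mul_eq_neg_mul h)).resolve_left two_ne
  have : IsCyclic (Subgroup.centralizer {X}) := by
    refine isCyclic_centralizer_of_trace_sq_ne_four ?_
    rw [trace_eq_zero hS, zero_pow two_ne_zero, show (4 : F) = 2 * 2 by norm_num]
    exact (mul_ne_zero two_ne two_ne).symm
  have map_le :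
      (Subgroup.centralizer {X}).map (toPSL 2 F) ≤ Subgroup.centralizer {toPSL 2 F X} := by
    rintro _ ⟨A, hA, rfl⟩
    exact toPSL_mem_centralizer_iff.2 (.inl (Subgroup.mem_centralizer_singleton_iff.1 hA))
  let N : Subgroup (Subgroup.centralizer {toPSL 2 F X}) :=
    ((Subgroup.centralizer {X}).map (toPSL 2 F)).subgroupOf _
  have : IsCyclic N := (Subgroup.subgroupOfEquivOfLe map_le).isCyclic.2
    (isCyclic_of_surjective _ ((toPSL 2 F).subgroupMap_surjective (Subgroup.centralizer {X})))
  refine isDihedral_of_isCyclic_of_index_eq_two N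
    (index_map_centralizer_subgroupOf hS not_commute) ?_
  rintro ⟨a, ha⟩ notMem
  obtain ⟨A, rfl⟩ := toPSL_surjective 2 F a
  have hA : A * X = -(X * A) :=
    (toPSL_mem_centralizer_iff.1 ha).resolve_left (toPSL_mem_map_centralizer_iff.not.1 notMem)
  have trace_A : A.1.trace = 0 := trace_eq_zero (A := X) (by rw [hA, neg_neg])
  exact Subtype.ext ((sq _).symm.trans (toPSL_sq_eq_one_of_trace_eq_zero trace_A))

theorem isMulCommutative_or_isDihedral_centralizer_PSL_two [Finite F] (x : PSL(2, F))
    (hx : x ≠ 1) :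
    IsMulCommutative (Subgroup.centralizer {x}) ∨ IsDihedral (Subgroup.centralizer {x}) := by
  obtain ⟨X, rfl⟩ := toPSL_surjective 2 F x
  by_cases! h : ∀ A : SL(2, F), A * X = -(X * A) → Commute A X
  · exact .inl (isMulCommutative_centralizer_toPSL hx h)
  · obtain ⟨S, hS, not_commute⟩ := h
    exact .inr (isDihedral_centralizer_toPSL hS not_commute)

theorem isFSZPlus_PSL_two : IsFSZPlus PSL(2, F) := by
  refine isFSZPlus_of_sq_eq_one_or_isMulCommutative_centralizer fun x => ?_
  obtain ⟨X, rfl⟩ := toPSL_surjective 2 F x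
  by_cases hX : toPSL 2 F X = 1
  · exact .inl (by rw [hX, one_pow])
  by_cases trace_eq : X.1.trace = 0
  · exact .inl (toPSL_sq_eq_one_of_trace_eq_zero trace_eq)
  · refine .inr (isMulCommutative_centralizer_toPSL hX fun A hA => ?_)
    exact commute_of_mul_eq_neg_mul_of_two_eq_zero ((mul_eq_zero.1
      (two_mul_trace_coe_eq_zero_of_mul_eq_neg_mul hA)).resolve_right trace_eq) hA

end ProjectiveSpecialLinearGroup

end

theorem mainTheorem11 :
    -- finite abelian groups are `FSZ`
    (∀ (A : Type*) [CommGroup A] [Fintype A], IsFSZ A) ∧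
    -- finite dihedral groups are `FSZ`
    (∀ (D : Type*) [Group D] [Fintype D], IsDihedral D → IsFSZ D) ∧
    -- for every finite field `F` with `q` elements, every nonidentity element of `PSL_2(q)` has an
    -- abelian or dihedral centralizer, and `PSL_2(q)` is `FSZ⁺`
    (∀ (F : Type*) [Field F] [Finite F],
      (∀ x : Matrix.ProjectiveSpecialLinearGroup (Fin 2) F, x ≠ 1 →
        IsMulCommutative (Subgroup.centralizer {x}) ∨ IsDihedral (Subgroup.centralizer {x})) ∧
      IsFSZPlus (Matrix.ProjectiveSpecialLinearGroup (Fin 2) F)) :=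
  ⟨fun A => isFSZ_of_commGroup A, fun D => isFSZ_of_isDihedral D,
    fun _ => ⟨isMulCommutative_or_isDihedral_centralizer_PSL_two, isFSZPlus_PSL_two⟩⟩
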